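/- Let $\phi:[0,\infty)\to\mathbb{R}$ and let $y_0\ge 0$ be such that $\phi$ is square-integrable on $[0,y_0]$. Let $(\lambda_n)_{n\in\mathbb{N}}$ be a non-decreasing sequence of positive real numbers tending to infinity, $(r_n)_{n\in\mathbb{N}}$ a sequence of complex numbers, $c\in\mathbb{R}$ and $X_0>0$, and suppose that for all $y\ge y_0$ and all $X\ge X_0$ $$\phi(y)=c+\Re\Big(\sum_{\lambda_n\le X}r_ne^{i\lambda_ny}\Big)+\mathcal{E}(y,X),$$ where $\mathcal{E}$ is real-valued, $y\mapsto\mathcal{E}(y,e^Y)$ is square-integrable on $[y_0,Y]$ for all sufficiently large $Y$, and $$\lim_{Y\to\infty}\frac1Y\int_{y_0}^Y|\mathcal{E}(y,e^Y)|^2\,dy=0.$$ Assume that one of the following two conditions holds (where $\ll$ refers to $n\to\infty$, respectively $T\to\infty$): (a) $r_n\ll\lambda_n^{-\beta}$ for some $\beta>\frac12$, and $\#\{n: T<\lambda_n\le T+1\}\ll\log T$. (b) $\#\{n: T<\lambda_n\le T+1\}\ll\log T$, and $\sum_{\lambda_n\le T}\lambda_n^2|r_n|^2\ll T^\theta$ for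 some $\theta$ with $0\le\theta<3-\sqrt3$. Then $\phi$ is $B^2$-almost periodic, that is, $\phi$ is locally square-integrable on $[0,\infty)$ and for every $\varepsilon>0$ there is a real-valued trigonometric polynomial $P(y)=\sum_{n=1}^{N}a_ne^{i\nu_ny}$ ($a_n\in\mathbb{C}$, $\nu_n\in\mathbb{R}$) with $$\limsup_{Y\to\infty}\frac1Y\int_0^Y|\phi(y)-P(y)|^2\,dy<\varepsilon^2;$$ and $\phi$ has a limiting distribution, that is, there is a Borel probability measure $\mu$ on $\mathbb{R}$ such that $$\lim_{Y\to\infty}\frac1Y\int_0^Yf(\phi(y))\,dy=\int_{\mathbb{R}}f\,d\mu$$ for every bounded continuous function $f:\mathbb{R}\to\mathbb{R}$. -/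

import Mathlib

open MeasureTheory Filter Topology Asymptotics
open scoped BoundedContinuousFunction

/-- `P` is a real-valued trigonometric polynomial:
`P y = ∑_{n < N} a_n e^{i ν_n y}` for all real `y`, with `a_n ∈ ℂ`, `ν_n ∈ ℝ`. -/
def IsRealTrigPoly (P : ℝ → ℝ) : Prop :=
  ∃ (N : ℕ) (a : Fin N → ℂ) (ν : Fin N → ℝ),
    ∀ y : ℝ, ((P y : ℝ) : ℂ) = ∑ n, a n * Complex.exp (Complex.I * (ν n : ℂ) * (y : ℂ))

/-- `φ` (only its values on `[0, ∞)` matter) is `B²`-almost periodic: it is locally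
square-integrable on `[0, ∞)` and, for every `ε > 0`, there is a real-valued trigonometric
polynomial `P` with `limsup_{Y → ∞} (1/Y) ∫_0^Y |φ - P|² < ε²`.
The limit superior is taken in the extended reals, so that it is never a default value. -/
def IsB2AlmostPeriodic (φ : ℝ → ℝ) : Prop :=
  (∀ Y : ℝ, MemLp φ 2 (volume.restrict (Set.Icc 0 Y))) ∧
  ∀ ε : ℝ, 0 < ε → ∃ P : ℝ → ℝ, IsRealTrigPoly P ∧
    limsup (fun Y : ℝ => (((1 / Y) * ∫ y in (0 : ℝ)..Y, |φ y - P y| ^ 2 : ℝ) : EReal)) atTop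
      < ((ε ^ 2 : ℝ) : EReal)

/-- The measurable function `φ` on `[0, ∞)` has the limiting distribution `μ`: `μ` is a
probability measure on `ℝ` and `(1/Y) ∫_0^Y f(φ(y)) dy → ∫ f dμ` as `Y → ∞` for all bounded
continuous `f`. -/
def HasLimitingDistribution (φ : ℝ → ℝ) (μ : Measure ℝ) : Prop :=
  IsProbabilityMeasure μ ∧ AEMeasurable φ (volume.restrict (Set.Ici 0)) ∧
  ∀ f : ℝ →ᵇ ℝ,
    Tendsto (fun Y : ℝ => (1 / Y) * ∫ y in (0 : ℝ)..Y, f (φ y)) atTop (𝓝 (∫ x, f x ∂μ))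

/-!
Write `A k` for the sum of the moduli `‖r n‖` over the indices with `⌈lam n⌉ = k`. The proof rests on
two facts about these bin masses.

The first is that `∑ A k ^ 2` converges under either hypothesis on the coefficients. If
`r n ≪ lam n ^ (-β)` with `β > 1/2`, then `A k ≪ k ^ (-β + δ)` for every `δ > 0`
(`summable_sq_sum_freqBin_of_isBigO_rpow`). If the second moment of `lam n * r n` is `O(T ^ θ)` with
`θ < 2`, then Cauchy–Schwarz in each bin and partial summation give the convergence
(`summable_sq_sum_freqBin_of_sum_sq_isBigO`). The range `θ < 3 - √3` lies inside `θ < 2`.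

The second is that a sum of `r n * exp (i * lam n * y)` over frequencies up to `e ^ Y` has mean square
`O(∑ A k ^ 2)` over `[0, Y]`, with an absolute constant (`integral_norm_sq_sum_exp_le_sum_binMass`).
Opening the square leads to a quadratic form in the `A k` whose kernel is `Y` for `|k - l| ≤ 1` and
`2 / (|k - l| - 1)` otherwise. The Schur test applies: the row sums over `l ≤ e ^ Y` are `O(Y)`, because the harmonic sum
`log (e ^ Y)` is no larger than the contribution `Y` of the diagonal. The truncation height `e ^ Y` in
the hypothesis on the error term is exactly what makes this work.

Truncating the formula at a fixed height `K` therefore leaves an error of mean square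
`O(∑_{k > K} A k ^ 2) + o(1)`, and `φ` is `B²`-almost periodic (`isB2AlmostPeriodic_of_summable_sq`).

Every `B²`-almost periodic function has a limiting distribution
(`IsB2AlmostPeriodic.exists_hasLimitingDistribution`). For a trigonometric polynomial `P` and a
continuous `f`, the mean value of `f ∘ P` exists, since by Weierstrass `f` may be replaced by a
polynomial. For bounded Lipschitz `f` this passes to `f ∘ φ` by mean square approximation. The
distributions of `φ` on `(0, Y]` have bounded second moments and so are tight, and by Prokhorov's
theorem they converge weakly.
-/

/-! ### A mean square bound for exponential sums -/

/-- An upper bound for `|∫_0^Y e^{ixy} dy|` when `|x| ≥ d - 1`. -/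
noncomputable def gapWeight (Y : ℝ) (d : ℕ) : ℝ := if d ≤ 1 then Y else 2 / ((d : ℝ) - 1)

lemma gapWeight_nonneg {Y : ℝ} (hY : 0 ≤ Y) (d : ℕ) : 0 ≤ gapWeight Y d := by
  unfold gapWeight
  split_ifs with h
  · exact hY
  · have : (1 : ℝ) ≤ d := by exact_mod_cast (by omega : 1 ≤ d)
    exact div_nonneg zero_le_two (by linarith)

lemma norm_exp_I_mul_mul (x y : ℝ) : ‖Complex.exp (Complex.I * (x : ℂ) * (y : ℂ))‖ = 1 := by
  have : Complex.I * (x : ℂ) * (y : ℂ) = ((x * y : ℝ) : ℂ) * Complex.I := by push_cast; ring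
  rw [this, Complex.norm_exp_ofReal_mul_I]

lemma norm_integral_exp_le {x : ℝ} (hx : x ≠ 0) (Y : ℝ) :
    ‖∫ y in (0 : ℝ)..Y, Complex.exp (Complex.I * (x : ℂ) * (y : ℂ))‖ ≤ 2 / |x| := by
  rw [integral_exp_mul_complex (by simpa using hx), norm_div, norm_mul, Complex.norm_I, one_mul,
    Complex.norm_real, Real.norm_eq_abs]
  gcongr
  refine (norm_sub_le _ _).trans ?_
  rw [norm_exp_I_mul_mul, norm_exp_I_mul_mul]
  norm_num

lemma norm_integral_exp_le_gapWeight {x Y : ℝ} (hY : 0 ≤ Y) {d : ℕ} (hd : (d : ℝ) - 1 ≤ |x|) :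
    ‖∫ y in (0 : ℝ)..Y, Complex.exp (Complex.I * (x : ℂ) * (y : ℂ))‖ ≤ gapWeight Y d := by
  unfold gapWeight
  split_ifs with h
  · refine (intervalIntegral.norm_integral_le_of_norm_le_const (C := 1)
      fun y _ => (norm_exp_I_mul_mul x y).le).trans ?_
    rw [sub_zero, one_mul, abs_of_nonneg hY]
  · have hd1 : (0 : ℝ) < (d : ℝ) - 1 := by
      have : (1 : ℝ) < d := by exact_mod_cast (by omega : 1 < d)
      linarith
    have hx : x ≠ 0 := abs_pos.mp (hd1.trans_le hd)
    exact (norm_integral_exp_le hx Y).trans (by gcongr)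

lemma natDist_ceil_sub_one_le {a b : ℝ} (ha : 0 < a) (hb : 0 < b) :
    (Nat.dist ⌈a⌉₊ ⌈b⌉₊ : ℝ) - 1 ≤ |a - b| := by
  have h1 := Nat.ceil_lt_add_one ha.le
  have h2 := Nat.ceil_lt_add_one hb.le
  have h3 := Nat.le_ceil a
  have h4 := Nat.le_ceil b
  rcases le_total ⌈a⌉₊ ⌈b⌉₊ with h | h
  · rw [Nat.dist_eq_sub_of_le h, Nat.cast_sub h, abs_sub_comm]
    exact le_trans (by linarith) (le_abs_self _)
  · rw [Nat.dist_comm, Nat.dist_eq_sub_of_le h, Nat.cast_sub h]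
    exact le_trans (by linarith) (le_abs_self _)

lemma sum_gapWeight_range_le {Y : ℝ} (hY : 0 ≤ Y) (N : ℕ) :
    ∑ d ∈ Finset.range (N + 1), gapWeight Y d ≤ 2 * Y + 2 * (1 + Real.log N) := by
  calc ∑ d ∈ Finset.range (N + 1), gapWeight Y d
      ≤ ∑ d ∈ Finset.range (N + 2), gapWeight Y d :=
        Finset.sum_le_sum_of_subset_of_nonneg (Finset.range_mono (by omega))
          fun d _ _ => gapWeight_nonneg hY d
    _ = 2 * Y + 2 * (harmonic N : ℝ) := by
        rw [Finset.sum_range_succ', Finset.sum_range_succ', harmonic, Rat.cast_sum, Finset.mul_sum]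
        have h : ∀ i : ℕ, gapWeight Y (i + 1 + 1) = 2 * (((i + 1 : ℕ) : ℚ)⁻¹ : ℚ) := by
          intro i
          unfold gapWeight
          rw [if_neg (by omega)]
          push_cast
          rw [div_eq_mul_inv]
          ring_nf
        have h0 : gapWeight Y 0 = Y := if_pos (by omega)
        have h1 : gapWeight Y (0 + 1) = Y := if_pos (by omega)
        rw [h0, h1, Finset.sum_congr rfl fun i _ => h i]
        ring
    _ ≤ _ := by gcongr; exact harmonic_le_one_add_log N

lemma sum_gapWeight_dist_le {Y : ℝ} (hY : 0 ≤ Y) {N k : ℕ} (hk : k ≤ N) :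
    ∑ l ∈ Finset.range (N + 1), gapWeight Y (Nat.dist k l) ≤
      2 * ∑ d ∈ Finset.range (N + 1), gapWeight Y d := by
  rw [← Finset.sum_filter_add_sum_filter_not _ (fun l => l ≤ k), two_mul]
  have key : ∀ s ⊆ Finset.range (N + 1), Set.InjOn (fun l => Nat.dist k l) s →
      ∑ l ∈ s, gapWeight Y (Nat.dist k l) ≤ ∑ d ∈ Finset.range (N + 1), gapWeight Y d := by
    intro s hs hinj
    rw [← Finset.sum_image (f := gapWeight Y) hinj]
    refine Finset.sum_le_sum_of_subset_of_nonneg ?_ fun d _ _ => gapWeight_nonneg hY d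
    intro d hd
    obtain ⟨l, hl, rfl⟩ := Finset.mem_image.mp hd
    have := Finset.mem_range.mp (hs hl)
    simp only [Finset.mem_range, Nat.dist]
    omega
  refine add_le_add (key _ (Finset.filter_subset _ _) ?_) (key _ (Finset.filter_subset _ _) ?_)
  all_goals
    intro a ha b hb hab
    simp only [Finset.coe_filter, Set.mem_ofPred_eq, Nat.dist] at ha hb hab
    omega

/-- The row sums of the matrix `gapWeight Y |k - l|` with `k, l ≤ e^Y + 1` are `O(Y)`: the
harmonic sum away from the diagonal is no larger than the trivial bound `Y` near the diagonal. -/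
lemma sum_gapWeight_dist_ceil_exp_le {Y : ℝ} (hY : 1 ≤ Y) {k : ℕ} (hk : k ≤ ⌈Real.exp Y⌉₊) :
    ∑ l ∈ Finset.range (⌈Real.exp Y⌉₊ + 1), gapWeight Y (Nat.dist k l) ≤ 16 * Y := by
  have hY0 : 0 ≤ Y := by linarith
  have hlog : Real.log ⌈Real.exp Y⌉₊ ≤ Y + 1 := by
    have hpos : (0 : ℝ) < ⌈Real.exp Y⌉₊ := by
      exact_mod_cast Nat.ceil_pos.mpr (Real.exp_pos Y)
    rw [Real.log_le_iff_le_exp hpos]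
    have h1 := (Nat.ceil_lt_add_one (Real.exp_pos Y).le).le
    have h2 : (1 : ℝ) ≤ Real.exp Y := Real.one_le_exp hY0
    have h3 : (2 : ℝ) ≤ Real.exp 1 := by linarith [Real.add_one_le_exp (1 : ℝ)]
    rw [Real.exp_add]
    nlinarith
  have h1 := sum_gapWeight_dist_le hY0 hk
  have h2 := sum_gapWeight_range_le hY0 ⌈Real.exp Y⌉₊
  linarith

/-- The Schur test: a symmetric nonnegative kernel with row sums at most `M` defines a quadratic
form bounded by `M ∑ a_k²`. -/
lemma sum_mul_mul_le_of_row_sum_le {ι : Type*} {s : Finset ι} {K : ι → ι → ℝ} {M : ℝ} (a : ι → ℝ)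
    (hK : ∀ k ∈ s, ∀ l ∈ s, 0 ≤ K k l) (hsymm : ∀ k l, K k l = K l k)
    (hM : ∀ k ∈ s, ∑ l ∈ s, K k l ≤ M) :
    ∑ k ∈ s, ∑ l ∈ s, a k * a l * K k l ≤ M * ∑ k ∈ s, a k ^ 2 := by
  have h1 : ∑ k ∈ s, ∑ l ∈ s, a k * a l * K k l ≤
      ∑ k ∈ s, ∑ l ∈ s, (a k ^ 2 * K k l / 2 + a l ^ 2 * K k l / 2) := by
    refine Finset.sum_le_sum fun k hk => Finset.sum_le_sum fun l hl => ?_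
    nlinarith [mul_nonneg (sq_nonneg (a k - a l)) (hK k hk l hl)]
  have h2 : ∑ k ∈ s, ∑ l ∈ s, a l ^ 2 * K k l / 2 = ∑ k ∈ s, ∑ l ∈ s, a k ^ 2 * K k l / 2 := by
    rw [Finset.sum_comm]
    simp_rw [hsymm]
  have h3 : ∑ k ∈ s, ∑ l ∈ s, a k ^ 2 * K k l / 2 ≤ ∑ k ∈ s, a k ^ 2 * M / 2 := by
    refine Finset.sum_le_sum fun k hk => ?_
    rw [← Finset.sum_div, ← Finset.mul_sum]
    have := hM k hk
    gcongr
  rw [← Finset.sum_div, ← Finset.sum_mul] at h3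
  simp_rw [Finset.sum_add_distrib] at h1
  linarith

/-- The total modulus of the coefficients `r n`, `n ∈ s`, whose frequency lies in `(k - 1, k]`. -/
noncomputable def binMass {ι : Type*} (lam : ι → ℝ) (r : ι → ℂ) (s : Finset ι) (k : ℕ) : ℝ :=
  ∑ n ∈ s with ⌈lam n⌉₊ = k, ‖r n‖

lemma binMass_nonneg {ι : Type*} (lam : ι → ℝ) (r : ι → ℂ) (s : Finset ι) (k : ℕ) :
    0 ≤ binMass lam r s k :=
  Finset.sum_nonneg fun _ _ => norm_nonneg _

lemma sum_sum_mul_eq_sum_binMass {ι : Type*} (lam : ι → ℝ) (r : ι → ℂ) {s : Finset ι}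
    {t : Finset ℕ} (ht : ∀ n ∈ s, ⌈lam n⌉₊ ∈ t) (K : ℕ → ℕ → ℝ) :
    ∑ n ∈ s, ∑ m ∈ s, ‖r n‖ * ‖r m‖ * K ⌈lam n⌉₊ ⌈lam m⌉₊ =
      ∑ k ∈ t, ∑ l ∈ t, binMass lam r s k * binMass lam r s l * K k l := by
  rw [← Finset.sum_fiberwise_of_maps_to ht]
  refine Finset.sum_congr rfl fun k _ => ?_
  have h : ∀ n ∈ s, ∑ m ∈ s, ‖r n‖ * ‖r m‖ * K ⌈lam n⌉₊ ⌈lam m⌉₊ =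
      ‖r n‖ * ∑ l ∈ t, binMass lam r s l * K ⌈lam n⌉₊ l := by
    intro n _
    rw [← Finset.sum_fiberwise_of_maps_to ht, Finset.mul_sum]
    refine Finset.sum_congr rfl fun l _ => ?_
    rw [binMass, Finset.sum_mul, Finset.mul_sum]
    refine Finset.sum_congr rfl fun m hm => ?_
    rw [(Finset.mem_filter.mp hm).2]
    ring
  rw [Finset.sum_congr rfl fun n hn => h n (Finset.mem_filter.mp hn).1]
  have h' : ∀ n ∈ s.filter (fun n => ⌈lam n⌉₊ = k),
      ‖r n‖ * ∑ l ∈ t, binMass lam r s l * K ⌈lam n⌉₊ l =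
        ‖r n‖ * ∑ l ∈ t, binMass lam r s l * K k l := by
    intro n hn
    rw [(Finset.mem_filter.mp hn).2]
  rw [Finset.sum_congr rfl h', ← Finset.sum_mul, ← binMass, Finset.mul_sum]
  refine Finset.sum_congr rfl fun l _ => ?_
  ring

lemma continuous_sum_exp {ι : Type*} (lam : ι → ℝ) (r : ι → ℂ) (s : Finset ι) :
    Continuous fun y : ℝ => ∑ n ∈ s, r n * Complex.exp (Complex.I * (lam n : ℂ) * (y : ℂ)) := by
  fun_prop

lemma integral_norm_sq_sum_exp_le {ι : Type*} (lam : ι → ℝ) (r : ι → ℂ) (s : Finset ι) (Y : ℝ) :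
    ∫ y in (0 : ℝ)..Y, ‖∑ n ∈ s, r n * Complex.exp (Complex.I * (lam n : ℂ) * (y : ℂ))‖ ^ 2 ≤
      ∑ n ∈ s, ∑ m ∈ s, ‖r n‖ * ‖r m‖ *
        ‖∫ y in (0 : ℝ)..Y, Complex.exp (Complex.I * ((lam n - lam m : ℝ) : ℂ) * (y : ℂ))‖ := by
  have hexp : ∀ y : ℝ,
      ((‖∑ n ∈ s, r n * Complex.exp (Complex.I * (lam n : ℂ) * (y : ℂ))‖ ^ 2 : ℝ) : ℂ) =
        ∑ n ∈ s, ∑ m ∈ s, r n * (starRingEnd ℂ) (r m) *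
          Complex.exp (Complex.I * ((lam n - lam m : ℝ) : ℂ) * (y : ℂ)) := by
    intro y
    rw [Complex.ofReal_pow, ← Complex.mul_conj', map_sum, Finset.sum_mul_sum]
    refine Finset.sum_congr rfl fun n _ => Finset.sum_congr rfl fun m _ => ?_
    rw [map_mul, ← Complex.exp_conj]
    simp only [map_mul, Complex.conj_I, Complex.conj_ofReal]
    rw [mul_mul_mul_comm, ← Complex.exp_add]
    congr 2
    push_cast
    ring
  have hint : ((∫ y in (0 : ℝ)..Y,
      ‖∑ n ∈ s, r n * Complex.exp (Complex.I * (lam n : ℂ) * (y : ℂ))‖ ^ 2 : ℝ) : ℂ) =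
        ∑ n ∈ s, ∑ m ∈ s, r n * (starRingEnd ℂ) (r m) *
          ∫ y in (0 : ℝ)..Y, Complex.exp (Complex.I * ((lam n - lam m : ℝ) : ℂ) * (y : ℂ)) := by
    rw [← intervalIntegral.integral_ofReal]
    simp_rw [hexp]
    rw [intervalIntegral.integral_finsetSum
      fun n _ => Continuous.intervalIntegrable (by fun_prop) _ _]
    refine Finset.sum_congr rfl fun n _ => ?_
    rw [intervalIntegral.integral_finsetSum
      fun m _ => Continuous.intervalIntegrable (by fun_prop) _ _]
    refine Finset.sum_congr rfl fun m _ => ?_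
    rw [intervalIntegral.integral_const_mul]
  refine (Real.le_norm_self _).trans ?_
  rw [← Complex.norm_real, hint]
  refine (norm_sum_le _ _).trans (Finset.sum_le_sum fun n _ => (norm_sum_le _ _).trans
    (Finset.sum_le_sum fun m _ => ?_))
  rw [norm_mul, norm_mul, RCLike.norm_conj]

/-- The mean square over `[0, Y]` of an exponential sum with frequencies up to `e^Y` is controlled
by the sum of the squares of the masses of its unit bins. -/
lemma integral_norm_sq_sum_exp_le_sum_binMass {ι : Type*} {lam : ι → ℝ} (r : ι → ℂ) {s : Finset ι}
    {Y : ℝ} (hY : 1 ≤ Y) (hpos : ∀ n ∈ s, 0 < lam n) (hle : ∀ n ∈ s, lam n ≤ Real.exp Y) :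
    ∫ y in (0 : ℝ)..Y, ‖∑ n ∈ s, r n * Complex.exp (Complex.I * (lam n : ℂ) * (y : ℂ))‖ ^ 2 ≤
      16 * Y * ∑ k ∈ Finset.range (⌈Real.exp Y⌉₊ + 1), binMass lam r s k ^ 2 := by
  have hY0 : 0 ≤ Y := by linarith
  have ht : ∀ n ∈ s, ⌈lam n⌉₊ ∈ Finset.range (⌈Real.exp Y⌉₊ + 1) := fun n hn =>
    Finset.mem_range.mpr (Nat.lt_succ_of_le (Nat.ceil_mono (hle n hn)))
  let K : ℕ → ℕ → ℝ := fun k l => gapWeight Y (Nat.dist k l)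
  have h1 : ∑ n ∈ s, ∑ m ∈ s, ‖r n‖ * ‖r m‖ *
      ‖∫ y in (0 : ℝ)..Y, Complex.exp (Complex.I * ((lam n - lam m : ℝ) : ℂ) * (y : ℂ))‖ ≤
      ∑ n ∈ s, ∑ m ∈ s, ‖r n‖ * ‖r m‖ * K ⌈lam n⌉₊ ⌈lam m⌉₊ :=
    Finset.sum_le_sum fun n hn => Finset.sum_le_sum fun m hm =>
      mul_le_mul_of_nonneg_left (norm_integral_exp_le_gapWeight hY0
        (natDist_ceil_sub_one_le (hpos n hn) (hpos m hm))) (by positivity)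
  rw [sum_sum_mul_eq_sum_binMass lam r ht K] at h1
  refine (integral_norm_sq_sum_exp_le lam r s Y).trans (h1.trans ?_)
  exact sum_mul_mul_le_of_row_sum_le (K := K) (binMass lam r s)
    (fun k _ l _ => gapWeight_nonneg hY0 _)
    (fun k l => congrArg (gapWeight Y) (Nat.dist_comm k l))
    fun k hk => sum_gapWeight_dist_ceil_exp_le hY (Nat.lt_succ_iff.mp (Finset.mem_range.mp hk))

/-! ### Square-summability of the bin masses -/

lemma finite_setOf_le_of_tendsto {lam : ℕ → ℝ} (h : Tendsto lam atTop atTop) (X : ℝ) :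
    {n | lam n ≤ X}.Finite := by
  have h1 := h.eventually (eventually_gt_atTop X)
  rw [← Nat.cofinite_eq_atTop, eventually_cofinite] at h1
  simpa using h1

/-- The finite set of indices `n` with `lam n ≤ X`. -/
noncomputable def freqsLE {lam : ℕ → ℝ} (h : Tendsto lam atTop atTop) (X : ℝ) : Finset ℕ :=
  (finite_setOf_le_of_tendsto h X).toFinset

section

variable {lam : ℕ → ℝ} (h : Tendsto lam atTop atTop)

lemma mem_freqsLE {X : ℝ} {n : ℕ} : n ∈ freqsLE h X ↔ lam n ≤ X := by simp [freqsLE]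

lemma finsum_eq_sum_freqsLE {M : Type*} [AddCommMonoid M] (f : ℕ → M) (X : ℝ) :
    ∑ᶠ (n : ℕ) (_ : lam n ≤ X), f n = ∑ n ∈ freqsLE h X, f n :=
  finsum_cond_eq_sum_of_cond_iff f fun _ => (mem_freqsLE h).symm

/-- The finite set of indices `n` with `⌈lam n⌉ = k`, that is, with `lam n ∈ (k - 1, k]` when
`k ≥ 1`. -/
noncomputable def freqBin (k : ℕ) : Finset ℕ := {n ∈ freqsLE h k | ⌈lam n⌉₊ = k}

lemma mem_freqBin {k n : ℕ} : n ∈ freqBin h k ↔ ⌈lam n⌉₊ = k := by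
  rw [freqBin, Finset.mem_filter, mem_freqsLE]
  exact ⟨fun H => H.2, fun H => ⟨H ▸ Nat.le_ceil _, H⟩⟩

lemma binMass_le_sum_freqBin (r : ℕ → ℂ) (s : Finset ℕ) (k : ℕ) :
    binMass lam r s k ≤ ∑ n ∈ freqBin h k, ‖r n‖ :=
  Finset.sum_le_sum_of_subset_of_nonneg
    (fun _ hn => (mem_freqBin h).mpr (Finset.mem_filter.mp hn).2) fun _ _ _ => norm_nonneg _

lemma half_le_of_mem_freqBin {k n : ℕ} (hk : 2 ≤ k) (hn : n ∈ freqBin h k) :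
    (k : ℝ) / 2 ≤ lam n := by
  rw [mem_freqBin] at hn
  have h1 : ((k - 1 : ℕ) : ℝ) < lam n := Nat.lt_ceil.mp (by omega)
  rw [Nat.cast_sub (by omega)] at h1
  have h2 : (2 : ℝ) ≤ k := by exact_mod_cast hk
  push_cast at h1
  linarith

lemma card_freqBin_isBigO_log
    (hcount : (fun T : ℝ => (Set.ncard {n : ℕ | T < lam n ∧ lam n ≤ T + 1} : ℝ))
      =O[atTop] fun T => Real.log T) :
    (fun k : ℕ => ((freqBin h k).card : ℝ)) =O[atTop] fun k : ℕ => Real.log k := by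
  have hshift : Tendsto (fun k : ℕ => (k : ℝ) - 1) atTop atTop :=
    tendsto_atTop_add_const_right _ _ tendsto_natCast_atTop_atTop
  have h1 := hcount.comp_tendsto hshift
  refine (IsBigO.congr' h1 ?_ EventuallyEq.rfl).trans ?_
  · filter_upwards [eventually_ge_atTop 1] with k hk
    simp only [Function.comp_apply]
    rw [← Set.ncard_coe_finset]
    congr 2
    ext n
    have hk' : k ≠ 0 := by omega
    rw [Finset.mem_coe, mem_freqBin, Nat.ceil_eq_iff hk', Nat.cast_sub hk]
    simp
  · refine IsBigO.of_bound 1 ?_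
    filter_upwards [eventually_ge_atTop 2] with k hk
    have hk' : (2 : ℝ) ≤ k := by exact_mod_cast hk
    simp only [Function.comp_apply]
    rw [Real.norm_of_nonneg (Real.log_nonneg (by linarith)),
      Real.norm_of_nonneg (Real.log_nonneg (by linarith)), one_mul]
    exact Real.log_le_log (by linarith) (by linarith)

lemma card_freqBin_isBigO_rpow
    (hcount : (fun T : ℝ => (Set.ncard {n : ℕ | T < lam n ∧ lam n ≤ T + 1} : ℝ))
      =O[atTop] fun T => Real.log T) {δ : ℝ} (hδ : 0 < δ) :
    (fun k : ℕ => ((freqBin h k).card : ℝ)) =O[atTop] fun k : ℕ => (k : ℝ) ^ δ :=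
  (card_freqBin_isBigO_log h hcount).trans
    ((isLittleO_log_rpow_atTop hδ).isBigO.comp_tendsto tendsto_natCast_atTop_atTop)

lemma summable_sq_sum_freqBin_of_isBigO_rpow (hpos : ∀ n, 0 < lam n)
    {r : ℕ → ℂ} {β : ℝ} (hβ : 1 / 2 < β) (hr : r =O[atTop] fun n => lam n ^ (-β))
    (hcount : (fun T : ℝ => (Set.ncard {n : ℕ | T < lam n ∧ lam n ≤ T + 1} : ℝ))
      =O[atTop] fun T => Real.log T) :
    Summable fun k => (∑ n ∈ freqBin h k, ‖r n‖) ^ 2 := by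
  obtain ⟨C, hC, hr⟩ := bound_of_isBigO_nat_atTop hr
  -- Any exponent in `(0, β - 1/2)` would do for the size of the bins.
  set δ := (β - 1 / 2) / 2 with hδ
  have h1 : (fun k : ℕ => ∑ n ∈ freqBin h k, ‖r n‖) =O[atTop]
      fun k : ℕ => (k : ℝ) ^ δ * (k : ℝ) ^ (-β) := by
    refine IsBigO.trans ?_ ((card_freqBin_isBigO_rpow h hcount (by linarith : 0 < δ)).mul
      (isBigO_refl _ _))
    refine IsBigO.of_bound (C * 2 ^ β) ?_
    filter_upwards [eventually_ge_atTop 2] with k hk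
    have hk0 : (0 : ℝ) < k := by exact_mod_cast (by omega : 0 < k)
    rw [Real.norm_of_nonneg (Finset.sum_nonneg fun _ _ => norm_nonneg _),
      Real.norm_of_nonneg (by positivity)]
    have hb : ∀ n ∈ freqBin h k, ‖r n‖ ≤ C * (2 ^ β * (k : ℝ) ^ (-β)) := by
      intro n hn
      refine (hr (Real.rpow_pos_of_pos (hpos n) _).ne').trans ?_
      rw [Real.norm_of_nonneg (Real.rpow_pos_of_pos (hpos n) _).le]
      gcongr
      calc lam n ^ (-β) ≤ ((k : ℝ) / 2) ^ (-β) :=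
            Real.rpow_le_rpow_of_nonpos (by positivity) (half_le_of_mem_freqBin h hk hn)
              (by linarith)
        _ = 2 ^ β * (k : ℝ) ^ (-β) := by
            rw [Real.div_rpow hk0.le zero_le_two, Real.rpow_neg zero_le_two, div_inv_eq_mul,
              mul_comm]
    calc _ ≤ (freqBin h k).card • (C * (2 ^ β * (k : ℝ) ^ (-β))) :=
          Finset.sum_le_card_nsmul _ _ _ hb
      _ = _ := by rw [nsmul_eq_mul]; ring
  refine summable_of_isBigO_nat (Real.summable_nat_rpow.mpr
    (by linarith : 2 * (δ - β) < -1)) ((h1.pow 2).trans (EventuallyEq.isBigO ?_))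
  filter_upwards [eventually_ge_atTop 1] with k hk
  have hk0 : (0 : ℝ) < k := by exact_mod_cast hk
  rw [← Real.rpow_add hk0, ← Real.rpow_natCast, ← Real.rpow_mul hk0.le]
  congr 1
  push_cast
  ring

lemma sum_Icc_sum_freqBin_le {f : ℕ → ℝ} (hf : ∀ n, 0 ≤ f n) (N : ℕ) :
    ∑ k ∈ Finset.Icc 1 N, ∑ n ∈ freqBin h k, f n ≤ ∑ n ∈ freqsLE h N, f n := by
  rw [← Finset.sum_biUnion]
  · refine Finset.sum_le_sum_of_subset_of_nonneg ?_ fun n _ _ => hf n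
    intro n hn
    obtain ⟨k, hk, hn⟩ := Finset.mem_biUnion.mp hn
    rw [mem_freqBin] at hn
    rw [mem_freqsLE]
    refine (Nat.le_ceil _).trans ?_
    rw [hn]
    exact_mod_cast (Finset.mem_Icc.mp hk).2
  · intro k _ l _ hkl
    refine Finset.disjoint_left.mpr fun n hn hn' => hkl ?_
    rw [mem_freqBin] at hn hn'
    exact hn.symm.trans hn'

/-- Cauchy–Schwarz inside each bin costs only a logarithm, so a power saving `θ < 2` in the second
moment suffices. -/
lemma summable_sq_sum_freqBin_of_sum_sq_isBigO {r : ℕ → ℂ} {θ : ℝ} (hθ0 : 0 ≤ θ) (hθ : θ < 2)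
    (hsum : (fun T : ℝ => ∑ᶠ (n : ℕ) (_ : lam n ≤ T), lam n ^ 2 * ‖r n‖ ^ 2)
      =O[atTop] fun T => T ^ θ)
    (hcount : (fun T : ℝ => (Set.ncard {n : ℕ | T < lam n ∧ lam n ≤ T + 1} : ℝ))
      =O[atTop] fun T => Real.log T) :
    Summable fun k => (∑ n ∈ freqBin h k, ‖r n‖) ^ 2 := by
  set δ := (2 - θ) / 2 with hδ
  set b : ℕ → ℝ := fun k => ∑ n ∈ freqBin h k, lam n ^ 2 * ‖r n‖ ^ 2 with hb
  have hb0 : ∀ k, 0 ≤ b k := fun k => Finset.sum_nonneg fun _ _ => by positivity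
  have hpartial : (fun N : ℕ => ∑ k ∈ Finset.Icc 1 N, b k) =O[atTop] fun N => (N : ℝ) ^ θ := by
    refine IsBigO.trans (IsBigO.of_bound 1 (Eventually.of_forall fun N => ?_))
      (hsum.comp_tendsto tendsto_natCast_atTop_atTop)
    simp only [Function.comp_apply]
    rw [one_mul, finsum_eq_sum_freqsLE h, Real.norm_of_nonneg (Finset.sum_nonneg fun k _ => hb0 k),
      Real.norm_of_nonneg (Finset.sum_nonneg fun _ _ => by positivity)]
    exact sum_Icc_sum_freqBin_le h (fun n => by positivity) N
  have hL : LSeriesSummable (fun k => (b k : ℂ)) ((2 - δ : ℝ) : ℂ) :=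
    LSeriesSummable_of_sum_norm_bigO_and_nonneg hpartial hb0 hθ0
      (by rw [Complex.ofReal_re]; linarith)
  have hL' := Summable.norm hL
  refine summable_of_isBigO_nat hL' ?_
  obtain ⟨C, hC⟩ := (card_freqBin_isBigO_rpow h hcount (by linarith : 0 < δ)).bound
  refine IsBigO.of_bound (C * 4) ?_
  filter_upwards [hC, eventually_ge_atTop 2] with k hCk hk
  have hk0 : (0 : ℝ) < k := by exact_mod_cast (by omega : 0 < k)
  rw [Real.norm_of_nonneg (by positivity), Real.norm_of_nonneg (by positivity)] at hCk
  rw [Real.norm_of_nonneg (by positivity), norm_norm, LSeries.norm_term_eq, if_neg (by omega),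
    Complex.ofReal_re, Complex.norm_real, Real.norm_of_nonneg (hb0 k)]
  have hr : ∑ n ∈ freqBin h k, ‖r n‖ ^ 2 ≤ 4 / (k : ℝ) ^ 2 * b k := by
    rw [hb, Finset.mul_sum]
    refine Finset.sum_le_sum fun n hn => ?_
    have h1 : ((k : ℝ) / 2) ^ 2 ≤ lam n ^ 2 :=
      pow_le_pow_left₀ (by positivity) (half_le_of_mem_freqBin h hk hn) 2
    rw [div_mul_eq_mul_div, le_div_iff₀ (by positivity)]
    nlinarith [sq_nonneg ‖r n‖]
  calc (∑ n ∈ freqBin h k, ‖r n‖) ^ 2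
      ≤ (freqBin h k).card * ∑ n ∈ freqBin h k, ‖r n‖ ^ 2 := sq_sum_le_card_mul_sum_sq
    _ ≤ (C * (k : ℝ) ^ δ) * (4 / (k : ℝ) ^ 2 * b k) := by
        refine mul_le_mul hCk hr (Finset.sum_nonneg fun _ _ => by positivity) ?_
        exact (Nat.cast_nonneg _).trans hCk
    _ = C * 4 * (b k / (k : ℝ) ^ (2 - δ)) := by
        rw [Real.rpow_sub hk0, Real.rpow_two]
        field_simp

end

/-! ### Trigonometric polynomials -/

/-- The exponential `y ↦ e^{iνy}` of frequency `ν`. -/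
noncomputable def expFreq (ν : ℝ) : ℝ → ℂ := fun y => Complex.exp (Complex.I * (ν : ℂ) * (y : ℂ))

/-- The space of complex trigonometric polynomials with arbitrary real frequencies. -/
noncomputable def trigPoly : Submodule ℂ (ℝ → ℂ) := Submodule.span ℂ (Set.range expFreq)

lemma expFreq_mem_trigPoly (ν : ℝ) : expFreq ν ∈ trigPoly :=
  Submodule.subset_span (Set.mem_range_self ν)

lemma expFreq_mul (ν ν' : ℝ) : expFreq ν * expFreq ν' = expFreq (ν + ν') := by
  funext y
  simp only [expFreq, Pi.mul_apply]
  rw [← Complex.exp_add]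
  congr 1
  push_cast
  ring

lemma expFreq_zero : expFreq 0 = 1 := by
  funext y
  simp [expFreq]

lemma conj_expFreq (ν y : ℝ) : (starRingEnd ℂ) (expFreq ν y) = expFreq (-ν) y := by
  simp only [expFreq]
  rw [← Complex.exp_conj]
  simp

lemma one_mem_trigPoly : (1 : ℝ → ℂ) ∈ trigPoly := expFreq_zero ▸ expFreq_mem_trigPoly 0

lemma mul_mem_trigPoly {f g : ℝ → ℂ} (hf : f ∈ trigPoly) (hg : g ∈ trigPoly) :
    f * g ∈ trigPoly := by
  have h := Submodule.mul_mem_mul hf hg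
  rw [trigPoly, Submodule.span_mul_span] at h
  refine Submodule.span_mono ?_ h
  rintro _ ⟨_, ⟨ν, rfl⟩, _, ⟨ν', rfl⟩, rfl⟩
  exact ⟨ν + ν', (expFreq_mul ν ν').symm⟩

lemma pow_mem_trigPoly {f : ℝ → ℂ} (hf : f ∈ trigPoly) (n : ℕ) : f ^ n ∈ trigPoly := by
  induction n with
  | zero => simpa using one_mem_trigPoly
  | succ n ih => rw [pow_succ]; exact mul_mem_trigPoly ih hf

lemma isRealTrigPoly_iff {P : ℝ → ℝ} :
    IsRealTrigPoly P ↔ (fun y => (P y : ℂ)) ∈ trigPoly := by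
  constructor
  · rintro ⟨N, a, ν, h⟩
    have : (fun y => (P y : ℂ)) = ∑ n, a n • expFreq (ν n) := by
      funext y
      rw [h y]
      simp [expFreq]
    rw [this]
    exact Submodule.sum_mem _ fun n _ => Submodule.smul_mem _ _ (expFreq_mem_trigPoly _)
  · intro h
    obtain ⟨c, hc⟩ := (Finsupp.mem_span_range_iff_exists_finsupp).mp h
    refine ⟨c.support.card, fun n => c (c.support.equivFin.symm n),
      fun n => (c.support.equivFin.symm n : ℝ), fun y => ?_⟩
    rw [← congrFun hc y, Finsupp.sum, Finset.sum_apply, ← Finset.sum_coe_sort,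
      ← Equiv.sum_comp c.support.equivFin.symm]
    simp [expFreq]

lemma isRealTrigPoly_const_add_re_sum {ι : Type*} (c : ℝ) (lam : ι → ℝ) (r : ι → ℂ)
    (s : Finset ι) : IsRealTrigPoly fun y =>
      c + (∑ n ∈ s, r n * Complex.exp (Complex.I * (lam n : ℂ) * (y : ℂ))).re := by
  rw [isRealTrigPoly_iff]
  have : (fun y : ℝ => ((c + (∑ n ∈ s, r n *
      Complex.exp (Complex.I * (lam n : ℂ) * (y : ℂ))).re : ℝ) : ℂ)) =
      (c : ℂ) • (1 : ℝ → ℂ) + (1 / 2 : ℂ) • (∑ n ∈ s, r n • expFreq (lam n) +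
        ∑ n ∈ s, (starRingEnd ℂ) (r n) • expFreq (-lam n)) := by
    funext y
    rw [Complex.ofReal_add, Complex.re_eq_add_conj, map_sum]
    simp only [Pi.add_apply, Pi.smul_apply, Finset.sum_apply, Pi.one_apply, smul_eq_mul,
      mul_one, map_mul, ← conj_expFreq]
    simp only [expFreq]
    ring
  rw [this]
  refine add_mem (Submodule.smul_mem _ _ one_mem_trigPoly) (Submodule.smul_mem _ _ (add_mem ?_ ?_))
  all_goals exact sum_mem fun n _ => Submodule.smul_mem _ _ (expFreq_mem_trigPoly _)

lemma continuous_of_mem_trigPoly {f : ℝ → ℂ} (hf : f ∈ trigPoly) : Continuous f := by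
  induction hf using Submodule.span_induction with
  | mem _ h => obtain ⟨ν, rfl⟩ := h; unfold expFreq; fun_prop
  | zero => exact continuous_zero
  | add _ _ _ _ h1 h2 => exact h1.add h2
  | smul a _ _ h => exact h.const_smul a

lemma exists_norm_le_of_mem_trigPoly {f : ℝ → ℂ} (hf : f ∈ trigPoly) : ∃ C, ∀ y, ‖f y‖ ≤ C := by
  induction hf using Submodule.span_induction with
  | mem _ h => obtain ⟨ν, rfl⟩ := h; exact ⟨1, fun y => (norm_exp_I_mul_mul ν y).le⟩
  | zero => exact ⟨0, fun y => by simp⟩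
  | add _ _ _ _ h1 h2 =>
    obtain ⟨C1, h1⟩ := h1
    obtain ⟨C2, h2⟩ := h2
    exact ⟨C1 + C2, fun y => (norm_add_le _ _).trans (add_le_add (h1 y) (h2 y))⟩
  | smul a _ _ h =>
    obtain ⟨C, h⟩ := h
    exact ⟨‖a‖ * C, fun y => (norm_smul_le a _).trans (mul_le_mul_of_nonneg_left (h y) (norm_nonneg a))⟩

lemma exists_mean_of_mem_trigPoly {f : ℝ → ℂ} (hf : f ∈ trigPoly) :
    ∃ m : ℂ, Tendsto (fun Y : ℝ => ((1 / Y : ℝ) : ℂ) * ∫ y in (0 : ℝ)..Y, f y) atTop (𝓝 m) := by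
  induction hf using Submodule.span_induction with
  | mem _ h =>
    obtain ⟨ν, rfl⟩ := h
    rcases eq_or_ne ν 0 with rfl | hν
    · refine ⟨1, tendsto_const_nhds.congr' ?_⟩
      filter_upwards [eventually_gt_atTop 0] with Y hY
      simp [expFreq_zero, hY.ne']
    · refine ⟨0, squeeze_zero_norm' (a := fun Y => 1 / Y * (2 / |ν|)) ?_ ?_⟩
      · filter_upwards [eventually_gt_atTop 0] with Y hY
        rw [norm_mul, Complex.norm_real, Real.norm_of_nonneg (by positivity)]
        exact mul_le_mul_of_nonneg_left (norm_integral_exp_le hν Y) (by positivity)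
      · simpa using (tendsto_inv_atTop_zero (𝕜 := ℝ)).mul_const (2 / |ν|)
  | zero => exact ⟨0, by simp⟩
  | add f g hf hg h1 h2 =>
    obtain ⟨m1, h1⟩ := h1
    obtain ⟨m2, h2⟩ := h2
    refine ⟨m1 + m2, (h1.add h2).congr fun Y => ?_⟩
    simp only [Pi.add_apply]
    rw [intervalIntegral.integral_add ((continuous_of_mem_trigPoly hf).intervalIntegrable _ _)
      ((continuous_of_mem_trigPoly hg).intervalIntegrable _ _)]
    ring
  | smul a _ _ h =>
    obtain ⟨m, h⟩ := h
    refine ⟨a * m, (h.const_mul a).congr fun Y => ?_⟩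
    simp only [Pi.smul_apply]
    rw [intervalIntegral.integral_smul, smul_eq_mul]
    ring

lemma IsRealTrigPoly.continuous {P : ℝ → ℝ} (hP : IsRealTrigPoly P) : Continuous P :=
  Complex.continuous_re.comp (continuous_of_mem_trigPoly (isRealTrigPoly_iff.mp hP))

lemma IsRealTrigPoly.exists_abs_le {P : ℝ → ℝ} (hP : IsRealTrigPoly P) : ∃ C, ∀ y, |P y| ≤ C := by
  simpa using exists_norm_le_of_mem_trigPoly (isRealTrigPoly_iff.mp hP)

lemma IsRealTrigPoly.eval_comp {P : ℝ → ℝ} (hP : IsRealTrigPoly P) (q : Polynomial ℝ) :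
    IsRealTrigPoly fun y => q.eval (P y) := by
  rw [isRealTrigPoly_iff] at hP ⊢
  have : (fun y => ((q.eval (P y) : ℝ) : ℂ)) =
      ∑ i ∈ Finset.range (q.natDegree + 1), (q.coeff i : ℂ) • (fun y => (P y : ℂ)) ^ i := by
    funext y
    rw [Polynomial.eval_eq_sum_range]
    simp
  rw [this]
  exact sum_mem fun i _ => Submodule.smul_mem _ _ (pow_mem_trigPoly hP i)

lemma IsRealTrigPoly.exists_mean {P : ℝ → ℝ} (hP : IsRealTrigPoly P) :
    ∃ m : ℝ, Tendsto (fun Y : ℝ => (1 / Y) * ∫ y in (0 : ℝ)..Y, P y) atTop (𝓝 m) := by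
  obtain ⟨m, hm⟩ := exists_mean_of_mem_trigPoly (isRealTrigPoly_iff.mp hP)
  refine ⟨m.re, ((Complex.continuous_re.tendsto m).comp hm).congr fun Y => ?_⟩
  rw [Function.comp_apply, intervalIntegral.integral_ofReal, ← Complex.ofReal_mul,
    Complex.ofReal_re]

/-! ### Mean values of functions of almost periodic functions -/

lemma exists_tendsto_of_forall_approx {u : ℝ → ℝ}
    (h : ∀ ε > 0, ∃ (v : ℝ → ℝ) (m : ℝ), Tendsto v atTop (𝓝 m) ∧
      ∀ᶠ Y in atTop, |u Y - v Y| ≤ ε) : ∃ m, Tendsto u atTop (𝓝 m) := by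
  refine cauchy_map_iff_exists_tendsto.mp (Metric.cauchy_iff.mpr ⟨inferInstance, fun ε hε => ?_⟩)
  obtain ⟨v, m, hv, huv⟩ := h (ε / 5) (by linarith)
  have hv' := Metric.tendsto_nhds.mp hv (ε / 5) (by linarith)
  refine ⟨u '' {Y | |u Y - v Y| ≤ ε / 5 ∧ dist (v Y) m < ε / 5},
    image_mem_map (huv.and hv'), ?_⟩
  rintro _ ⟨Y, ⟨h1, h2⟩, rfl⟩ _ ⟨Z, ⟨h3, h4⟩, rfl⟩
  rw [Real.dist_eq, abs_lt] at *
  rw [abs_le] at h1 h3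
  constructor <;> linarith

lemma abs_mean_sub_le {f g : ℝ → ℝ} {Y B : ℝ} (hY : 0 < Y)
    (hf : IntervalIntegrable f volume 0 Y) (hg : IntervalIntegrable g volume 0 Y)
    {b : ℝ → ℝ} (hb : IntervalIntegrable b volume 0 Y) (hfg : ∀ y, |f y - g y| ≤ b y)
    (hB : (1 / Y) * ∫ y in (0 : ℝ)..Y, b y ≤ B) :
    |(1 / Y) * (∫ y in (0 : ℝ)..Y, f y) - (1 / Y) * ∫ y in (0 : ℝ)..Y, g y| ≤ B := by
  rw [← mul_sub, ← intervalIntegral.integral_sub hf hg, abs_mul, abs_of_pos (by positivity)]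
  refine le_trans (mul_le_mul_of_nonneg_left ?_ (by positivity)) hB
  exact intervalIntegral.norm_integral_le_of_norm_le (f := fun y => f y - g y) hY.le
    (Eventually.of_forall fun y _ => hfg y) hb

/-- By the Weierstrass approximation theorem, `f ∘ P` is a uniform limit of polynomials in `P`,
which are again trigonometric polynomials. -/
lemma IsRealTrigPoly.exists_mean_comp {P : ℝ → ℝ} (hP : IsRealTrigPoly P) {f : ℝ → ℝ}
    (hf : Continuous f) :
    ∃ m : ℝ, Tendsto (fun Y : ℝ => (1 / Y) * ∫ y in (0 : ℝ)..Y, f (P y)) atTop (𝓝 m) := by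
  obtain ⟨C, hC⟩ := hP.exists_abs_le
  refine exists_tendsto_of_forall_approx fun ε hε => ?_
  obtain ⟨q, hq⟩ := exists_polynomial_near_of_continuousOn (-C) C f hf.continuousOn ε hε
  obtain ⟨m, hm⟩ := (hP.eval_comp q).exists_mean
  refine ⟨_, m, hm, ?_⟩
  filter_upwards [eventually_gt_atTop 0] with Y hY
  refine abs_mean_sub_le hY ((hf.comp hP.continuous).intervalIntegrable _ _)
    ((hP.eval_comp q).continuous.intervalIntegrable _ _) (b := fun _ => ε)
    intervalIntegrable_const (fun y => ?_) ?_
  · rw [abs_sub_comm]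
    exact (hq _ (abs_le.mp (hC y))).le
  · rw [intervalIntegral.integral_const, smul_eq_mul, sub_zero]
    field_simp
    exact le_rfl

lemma IsRealTrigPoly.memLp {P : ℝ → ℝ} (hP : IsRealTrigPoly P) (a b : ℝ) :
    MemLp P 2 (volume.restrict (Set.Icc a b)) := by
  obtain ⟨C, hC⟩ := hP.exists_abs_le
  exact MemLp.of_bound hP.continuous.aestronglyMeasurable C (Eventually.of_forall hC)

lemma intervalIntegrable_sq_of_memLp {g : ℝ → ℝ} {a b : ℝ} (hab : a ≤ b)
    (hg : MemLp g 2 (volume.restrict (Set.Icc a b))) :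
    IntervalIntegrable (fun y => |g y| ^ 2) volume a b := by
  rw [intervalIntegrable_iff_integrableOn_Icc_of_le hab]
  simp only [sq_abs]
  exact hg.integrable_sq

lemma IsB2AlmostPeriodic.intervalIntegrable_comp {φ : ℝ → ℝ} (hφ : IsB2AlmostPeriodic φ)
    {f : ℝ → ℝ} (hf : Continuous f) {C : ℝ} (hC : ∀ x, |f x| ≤ C) {Y : ℝ} (hY : 0 ≤ Y) :
    IntervalIntegrable (fun y => f (φ y)) volume 0 Y := by
  rw [intervalIntegrable_iff_integrableOn_Icc_of_le hY]
  exact (MemLp.of_bound (hf.comp_aestronglyMeasurable (hφ.1 Y).1) C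
    (Eventually.of_forall fun y => hC _)).integrable le_rfl

lemma IsB2AlmostPeriodic.exists_eventually_lt {φ : ℝ → ℝ} (hφ : IsB2AlmostPeriodic φ)
    {ε : ℝ} (hε : 0 < ε) : ∃ P : ℝ → ℝ, IsRealTrigPoly P ∧
      ∀ᶠ Y : ℝ in atTop, (1 / Y) * ∫ y in (0 : ℝ)..Y, |φ y - P y| ^ 2 < ε ^ 2 := by
  obtain ⟨P, hP, hlim⟩ := hφ.2 ε hε
  exact ⟨P, hP, (eventually_lt_of_limsup_lt hlim).mono fun Y hY => EReal.coe_lt_coe_iff.mp hY⟩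

lemma IsB2AlmostPeriodic.exists_mean_comp {φ : ℝ → ℝ} (hφ : IsB2AlmostPeriodic φ) {f : ℝ → ℝ}
    {L : NNReal} (hf : LipschitzWith L f) {C : ℝ} (hC : ∀ x, |f x| ≤ C) :
    ∃ m : ℝ, Tendsto (fun Y : ℝ => (1 / Y) * ∫ y in (0 : ℝ)..Y, f (φ y)) atTop (𝓝 m) := by
  refine exists_tendsto_of_forall_approx fun ε hε => ?_
  -- `δ` is chosen so that `L * δ ≤ ε`.
  set δ := ε / (L + 1) with hδ
  have hL : (0 : ℝ) ≤ L := L.2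
  have hδ0 : 0 < δ := by positivity
  obtain ⟨P, hP, hev⟩ := hφ.exists_eventually_lt hδ0
  obtain ⟨m, hm⟩ := hP.exists_mean_comp hf.continuous
  refine ⟨_, m, hm, ?_⟩
  filter_upwards [hev, eventually_gt_atTop 0] with Y hYlt hY
  have hint := intervalIntegrable_sq_of_memLp hY.le ((hφ.1 Y).sub (hP.memLp 0 Y))
  simp only [Pi.sub_apply] at hint
  -- The pointwise bound `2 |x| ≤ |x|² / δ + δ` replaces the Cauchy–Schwarz inequality.
  refine abs_mean_sub_le hY (hφ.intervalIntegrable_comp hf.continuous hC hY.le)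
    ((hf.continuous.comp hP.continuous).intervalIntegrable _ _)
    (b := fun y => (L / (2 * δ)) * |φ y - P y| ^ 2 + L * δ / 2)
    ((hint.const_mul _).add intervalIntegrable_const) (fun y => ?_) ?_
  · have h1 := hf.dist_le_mul (φ y) (P y)
    rw [Real.dist_eq, Real.dist_eq] at h1
    refine h1.trans ?_
    have h2 : |φ y - P y| ≤ |φ y - P y| ^ 2 / (2 * δ) + δ / 2 := by
      rw [div_add_div _ _ (by positivity) two_ne_zero, le_div_iff₀ (by positivity)]
      nlinarith [sq_nonneg (|φ y - P y| - δ)]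
    calc (L : ℝ) * |φ y - P y| ≤ L * (|φ y - P y| ^ 2 / (2 * δ) + δ / 2) := by gcongr
      _ = _ := by ring
  · rw [intervalIntegral.integral_add (hint.const_mul _) intervalIntegrable_const,
      intervalIntegral.integral_const_mul, intervalIntegral.integral_const, smul_eq_mul, sub_zero]
    calc _ = L / (2 * δ) * ((1 / Y) * ∫ y in (0 : ℝ)..Y, |φ y - P y| ^ 2) + L * δ / 2 := by
          field_simp
      _ ≤ L / (2 * δ) * δ ^ 2 + L * δ / 2 := by gcongr
      _ = L * δ := by field_simp; ring
      _ ≤ ε := by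
          rw [hδ, mul_div_assoc', div_le_iff₀ (by positivity)]
          nlinarith

/-! ### Limiting distributions -/

lemma aemeasurable_restrict_Ici_of_memLp {φ : ℝ → ℝ}
    (hφ : ∀ Y : ℝ, MemLp φ 2 (volume.restrict (Set.Icc 0 Y))) :
    AEMeasurable φ (volume.restrict (Set.Ici 0)) := by
  have hU : Set.Ici (0 : ℝ) = ⋃ n : ℕ, Set.Icc (0 : ℝ) n := by
    ext x
    simp only [Set.mem_Ici, Set.mem_iUnion, Set.mem_Icc, exists_and_left]
    exact ⟨fun h => ⟨h, exists_nat_ge x⟩, fun h => h.1⟩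
  rw [hU, aemeasurable_iUnion_iff]
  exact fun n => (hφ n).1.aemeasurable

/-- The distribution of `φ` under the uniform probability measure on `(0, Y]`. The endpoint
`max Y 1` in place of `Y` makes it a probability measure for every real `Y`. -/
noncomputable def meanDist {φ : ℝ → ℝ} (hφ : AEMeasurable φ (volume.restrict (Set.Ici 0)))
    (Y : ℝ) : ProbabilityMeasure ℝ :=
  ⟨((ENNReal.ofReal (max Y 1))⁻¹ • volume.restrict (Set.Ioc 0 (max Y 1))).map φ, by
    have : IsProbabilityMeasure
        ((ENNReal.ofReal (max Y 1))⁻¹ • (volume.restrict (Set.Ioc 0 (max Y 1)) : Measure ℝ)) := by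
      constructor
      rw [Measure.smul_apply, Measure.restrict_apply_univ, Real.volume_Ioc, sub_zero, smul_eq_mul,
        ENNReal.inv_mul_cancel (by simp) ENNReal.ofReal_ne_top]
    refine Measure.isProbabilityMeasure_map (AEMeasurable.smul_measure ?_ _)
    exact hφ.mono_set fun x hx => hx.1.le⟩

lemma aemeasurable_smul_restrict_Ioc {φ : ℝ → ℝ}
    (hφ : AEMeasurable φ (volume.restrict (Set.Ici 0))) (Y : ℝ) (c : ENNReal) :
    AEMeasurable φ (c • volume.restrict (Set.Ioc 0 Y)) :=
  AEMeasurable.smul_measure (hφ.mono_set fun _ hx => hx.1.le) c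

section

variable {φ : ℝ → ℝ} (hφ : AEMeasurable φ (volume.restrict (Set.Ici 0)))

lemma integral_meanDist {g : ℝ → ℝ} (hg : Continuous g) {Y : ℝ} (hY : 1 ≤ Y) :
    ∫ x, g x ∂(meanDist hφ Y : Measure ℝ) = (1 / Y) * ∫ y in (0 : ℝ)..Y, g (φ y) := by
  simp only [meanDist, ProbabilityMeasure.coe_mk, max_eq_left hY]
  rw [integral_map (aemeasurable_smul_restrict_Ioc hφ _ _) hg.aestronglyMeasurable,
    integral_smul_measure, intervalIntegral.integral_of_le (by linarith), ENNReal.toReal_inv,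
    ENNReal.toReal_ofReal (by linarith), smul_eq_mul, one_div]

lemma integrable_meanDist {g : ℝ → ℝ} (hg : Continuous g) {Y : ℝ} (hY : 1 ≤ Y)
    (hint : IntervalIntegrable (fun y => g (φ y)) volume 0 Y) :
    Integrable g (meanDist hφ Y : Measure ℝ) := by
  simp only [meanDist, ProbabilityMeasure.coe_mk, max_eq_left hY]
  rw [integrable_map_measure hg.aestronglyMeasurable (aemeasurable_smul_restrict_Ioc hφ _ _)]
  refine Integrable.smul_measure ?_ ?_
  · exact (intervalIntegrable_iff_integrableOn_Ioc_of_le (by linarith)).mp hint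
  · simp; linarith

end

lemma IsB2AlmostPeriodic.exists_eventually_mean_sq_le {φ : ℝ → ℝ} (hφ : IsB2AlmostPeriodic φ) :
    ∃ M : ℝ, ∀ᶠ Y : ℝ in atTop, (1 / Y) * ∫ y in (0 : ℝ)..Y, |φ y| ^ 2 ≤ M := by
  obtain ⟨P, hP, hev⟩ := hφ.exists_eventually_lt one_pos
  obtain ⟨C, hC⟩ := hP.exists_abs_le
  refine ⟨2 * 1 ^ 2 + 2 * C ^ 2, ?_⟩
  filter_upwards [hev, eventually_gt_atTop 0] with Y hYlt hY
  have hint := intervalIntegrable_sq_of_memLp hY.le ((hφ.1 Y).sub (hP.memLp 0 Y))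
  simp only [Pi.sub_apply] at hint
  have hle : ∫ y in (0 : ℝ)..Y, |φ y| ^ 2 ≤
      ∫ y in (0 : ℝ)..Y, (2 * |φ y - P y| ^ 2 + 2 * C ^ 2) := by
    refine intervalIntegral.integral_mono_on hY.le (intervalIntegrable_sq_of_memLp hY.le (hφ.1 Y))
      ((hint.const_mul _).add intervalIntegrable_const) fun y _ => ?_
    have h1 : P y ^ 2 ≤ C ^ 2 := sq_le_sq' (abs_le.mp (hC y)).1 (abs_le.mp (hC y)).2
    rw [sq_abs, sq_abs]
    nlinarith [sq_nonneg (φ y - 2 * P y)]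
  rw [intervalIntegral.integral_add (hint.const_mul _) intervalIntegrable_const,
    intervalIntegral.integral_const_mul, intervalIntegral.integral_const, smul_eq_mul,
    sub_zero] at hle
  calc _ ≤ (1 / Y) * (2 * (∫ y in (0 : ℝ)..Y, |φ y - P y| ^ 2) + Y * (2 * C ^ 2)) := by gcongr
    _ = 2 * ((1 / Y) * ∫ y in (0 : ℝ)..Y, |φ y - P y| ^ 2) + 2 * C ^ 2 := by field_simp
    _ ≤ _ := by gcongr

/-- The distributions of an almost periodic function on long intervals are tight, because their
second moments are bounded. -/
lemma IsB2AlmostPeriodic.exists_isTightMeasureSet {φ : ℝ → ℝ} (hφ : IsB2AlmostPeriodic φ)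
    (hmeas : AEMeasurable φ (volume.restrict (Set.Ici 0))) :
    ∃ Y₁ : ℝ, IsTightMeasureSet
      {((μ : ProbabilityMeasure ℝ) : Measure ℝ) | μ ∈ meanDist hmeas '' Set.Ici Y₁} := by
  obtain ⟨M, hM⟩ := hφ.exists_eventually_mean_sq_le
  obtain ⟨Y₁, hY₁⟩ := eventually_atTop.mp (hM.and (eventually_ge_atTop 1))
  refine ⟨Y₁, isTightMeasureSet_iff_exists_isCompact_measure_compl_le.mpr fun ε hε => ?_⟩
  obtain ⟨δ, hδ0, hδ⟩ : ∃ δ : ℝ, 0 < δ ∧ ENNReal.ofReal δ ≤ ε := by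
    obtain ⟨δ, hδ0, hδ⟩ := ENNReal.lt_iff_exists_nnreal_btwn.mp hε
    exact ⟨δ, by exact_mod_cast hδ0, by simpa using hδ.le⟩
  set R := Real.sqrt ((|M| + 1) / δ) with hR
  have hR2 : R ^ 2 = (|M| + 1) / δ := Real.sq_sqrt (by positivity)
  refine ⟨Metric.closedBall 0 R, isCompact_closedBall 0 R, ?_⟩
  rintro _ ⟨_, ⟨Y, hY, rfl⟩, rfl⟩
  obtain ⟨hMY, h1Y⟩ := hY₁ Y hY
  refine le_trans ?_ hδ
  rw [← ENNReal.ofReal_toReal (measure_ne_top _ _)]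
  refine ENNReal.ofReal_le_ofReal ?_
  have hint : IntervalIntegrable (fun y => φ y ^ 2) volume 0 Y := by
    simpa only [sq_abs] using intervalIntegrable_sq_of_memLp (by linarith) (hφ.1 Y)
  have hcont : Continuous fun x : ℝ => x ^ 2 := by fun_prop
  have hmarkov := mul_meas_ge_le_integral_of_nonneg
    (μ := (meanDist hmeas Y : Measure ℝ)) (Eventually.of_forall fun x : ℝ => sq_nonneg x)
    (integrable_meanDist hmeas hcont h1Y hint) (R ^ 2)
  rw [integral_meanDist hmeas hcont h1Y] at hmarkov
  simp only [sq_abs] at hMY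
  have hsub : (Metric.closedBall (0 : ℝ) R)ᶜ ⊆ {x : ℝ | R ^ 2 ≤ x ^ 2} := by
    intro x hx
    have hx' : R < |x| := by simpa using hx
    show R ^ 2 ≤ x ^ 2
    rw [← sq_abs x]
    exact pow_le_pow_left₀ (Real.sqrt_nonneg _) hx'.le 2
  have hmono : (meanDist hmeas Y : Measure ℝ).real (Metric.closedBall (0 : ℝ) R)ᶜ ≤
      (meanDist hmeas Y : Measure ℝ).real {x : ℝ | R ^ 2 ≤ x ^ 2} := measureReal_mono hsub
  refine hmono.trans ?_
  have h2 := hmarkov.trans (hMY.trans (le_abs_self M))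
  rw [hR2, div_mul_eq_mul_div, div_le_iff₀ hδ0] at h2
  rw [hR2]
  by_contra! hcon
  nlinarith [abs_nonneg M]

/-- By Prokhorov's theorem the distributions on `(0, Y]` have a weak cluster point, and they
converge to it because the mean values of bounded Lipschitz functions of `φ` exist. -/
lemma IsB2AlmostPeriodic.exists_hasLimitingDistribution {φ : ℝ → ℝ} (hφ : IsB2AlmostPeriodic φ) :
    ∃ μ : Measure ℝ, HasLimitingDistribution φ μ := by
  have hmeas := aemeasurable_restrict_Ici_of_memLp hφ.1
  obtain ⟨Y₁, htight⟩ := hφ.exists_isTightMeasureSet hmeas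
  have hcpt : IsCompact (closure (meanDist hmeas '' Set.Ici Y₁)) :=
    isCompact_closure_of_isTightMeasureSet htight
  have hmem : ∀ᶠ Y in atTop, meanDist hmeas Y ∈ closure (meanDist hmeas '' Set.Ici Y₁) :=
    (eventually_ge_atTop Y₁).mono fun Y hY => subset_closure (Set.mem_image_of_mem _ hY)
  obtain ⟨μ, -, hμ⟩ := hcpt.exists_mapClusterPt_of_frequently hmem.frequently
  have hconv : Tendsto (meanDist hmeas) atTop (𝓝 μ) := by
    refine tendsto_iff_forall_lipschitz_integral_tendsto.mpr fun f hbdd hlip => ?_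
    obtain ⟨C, hC⟩ := hbdd
    obtain ⟨L, hL⟩ := hlip
    have hC' : ∀ x, |f x| ≤ C + |f 0| := fun x => by
      have h1 := hC x 0
      rw [Real.dist_eq] at h1
      linarith [abs_sub_abs_le_abs_sub (f x) (f 0)]
    obtain ⟨m, hm⟩ := hφ.exists_mean_comp hL hC'
    have hm' : Tendsto (fun Y => ∫ x, f x ∂(meanDist hmeas Y : Measure ℝ)) atTop (𝓝 m) := by
      refine hm.congr' ?_
      filter_upwards [eventually_ge_atTop 1] with Y hY
      exact (integral_meanDist hmeas hL.continuous hY).symm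
    let f' : ℝ →ᵇ ℝ := ⟨⟨f, hL.continuous⟩, ⟨C, hC⟩⟩
    have hcont : Continuous fun ν : ProbabilityMeasure ℝ => ∫ x, f x ∂(ν : Measure ℝ) :=
      continuous_iff_continuousAt.mpr fun ν =>
        (ProbabilityMeasure.tendsto_iff_forall_integral_tendsto.mp tendsto_id) f'
    have hcl := hμ.continuousAt_comp hcont.continuousAt
    have : (∫ x, f x ∂(μ : Measure ℝ)) = m :=
      eq_of_nhds_neBot (hcl.clusterPt.mono hm').neBot
    rw [this]
    exact hm'
  refine ⟨μ, inferInstance, hmeas, fun f => ?_⟩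
  refine ((ProbabilityMeasure.tendsto_iff_forall_integral_tendsto.mp hconv) f).congr' ?_
  filter_upwards [eventually_ge_atTop 1] with Y hY
  exact integral_meanDist hmeas f.continuous hY

/-! ### Almost periodicity from square-summable bin masses -/

lemma memLp_two_union {g : ℝ → ℝ} {s t : Set ℝ} (hs : MemLp g 2 (volume.restrict s))
    (ht : MemLp g 2 (volume.restrict t)) : MemLp g 2 (volume.restrict (s ∪ t)) := by
  have hm : AEStronglyMeasurable g (volume.restrict (s ∪ t)) :=
    aestronglyMeasurable_union_iff.mpr ⟨hs.1, ht.1⟩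
  rw [memLp_two_iff_integrable_sq hm]
  exact IntegrableOn.union ((memLp_two_iff_integrable_sq hs.1).mp hs)
    ((memLp_two_iff_integrable_sq ht.1).mp ht)

section

variable {lam : ℕ → ℝ} (h : Tendsto lam atTop atTop) {r : ℕ → ℂ}

/-- The tail of the exponential sum over `K < lam n ≤ e^Y` has small mean square over `[0, Y]`,
uniformly in `Y`, once `K` is large. -/
lemma exists_forall_integral_tail_le (hpos : ∀ n, 0 < lam n)
    (hsum : Summable fun k => (∑ n ∈ freqBin h k, ‖r n‖) ^ 2) {η : ℝ} (hη : 0 < η) :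
    ∃ K : ℕ, ∀ Y : ℝ, 1 ≤ Y →
      ∫ y in (0 : ℝ)..Y, ‖∑ n ∈ (freqsLE h (Real.exp Y)).filter (fun n => ¬ lam n ≤ K),
        r n * Complex.exp (Complex.I * (lam n : ℂ) * (y : ℂ))‖ ^ 2 ≤ 16 * Y * η := by
  obtain ⟨u, hu⟩ := summable_iff_vanishing_norm.mp hsum η hη
  refine ⟨u.sup id, fun Y hY => ?_⟩
  set s := (freqsLE h (Real.exp Y)).filter (fun n => ¬ lam n ≤ (u.sup id : ℕ)) with hs
  refine (integral_norm_sq_sum_exp_le_sum_binMass r hY (fun n _ => hpos n) fun n hn =>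
    (mem_freqsLE h).mp (Finset.mem_filter.mp hn).1).trans ?_
  refine mul_le_mul_of_nonneg_left ?_ (by linarith)
  set N := ⌈Real.exp Y⌉₊ + 1
  have hzero : ∀ k ∈ Finset.range N, k ∉ (Finset.range N).filter (fun k => u.sup id < k) →
      binMass lam r s k ^ 2 = 0 := by
    intro k hk hk'
    have hkK : k ≤ u.sup id := by
      by_contra hcon
      exact hk' (Finset.mem_filter.mpr ⟨hk, not_le.mp hcon⟩)
    rw [binMass, Finset.filter_eq_empty_iff.mpr, Finset.sum_empty, zero_pow two_ne_zero]
    intro n hn hnk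
    refine (Finset.mem_filter.mp hn).2 ((Nat.le_ceil _).trans ?_)
    rw [hnk]
    exact_mod_cast hkK
  rw [← Finset.sum_subset (Finset.filter_subset _ _) hzero]
  calc _ ≤ ∑ k ∈ (Finset.range N).filter (fun k => u.sup id < k),
        (∑ n ∈ freqBin h k, ‖r n‖) ^ 2 :=
        Finset.sum_le_sum fun k _ => pow_le_pow_left₀ (binMass_nonneg _ _ _ _)
          (binMass_le_sum_freqBin h r s k) 2
    _ ≤ _ := (Real.le_norm_self _).trans (hu _ ?_).le
  refine Finset.disjoint_left.mpr fun k hk hku => ?_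
  exact absurd (Finset.le_sup (f := id) hku) (not_le.mpr (Finset.mem_filter.mp hk).2)

variable {φ : ℝ → ℝ} {y₀ c X₀ : ℝ} {E : ℝ → ℝ → ℝ}

lemma memLp_two_of_formula
    (hφ : MemLp φ 2 (volume.restrict (Set.Icc 0 y₀)))
    (hformula : ∀ y, y₀ ≤ y → ∀ X, X₀ ≤ X →
      φ y = c + (∑ n ∈ freqsLE h X,
        r n * Complex.exp (Complex.I * (lam n : ℂ) * (y : ℂ))).re + E y X)
    (hE_L2 : ∀ᶠ Y : ℝ in atTop,
      MemLp (fun y => E y (Real.exp Y)) 2 (volume.restrict (Set.Icc y₀ Y))) (Y : ℝ) :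
    MemLp φ 2 (volume.restrict (Set.Icc 0 Y)) := by
  obtain ⟨Z, hZ, hZY, hZX⟩ := (hE_L2.and ((eventually_ge_atTop Y).and
    (Real.tendsto_exp_atTop.eventually_ge_atTop X₀))).exists
  have hP := isRealTrigPoly_const_add_re_sum c lam r (freqsLE h (Real.exp Z))
  have h2 : MemLp φ 2 (volume.restrict (Set.Icc y₀ Z)) := by
    refine ((hP.memLp y₀ Z).add hZ).ae_eq ?_
    filter_upwards [ae_restrict_mem measurableSet_Icc] with y hy
    exact (hformula y hy.1 _ hZX).symm
  refine (memLp_two_union hφ h2).mono_measure (Measure.restrict_mono (fun x hx => ?_) le_rfl)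
  rcases le_total x y₀ with hxy | hxy
  · exact Or.inl ⟨hx.1, hxy⟩
  · exact Or.inr ⟨hxy, hx.2.trans hZY⟩

/-- The approximating trigonometric polynomials are the truncations of the explicit formula at a
fixed height `K`. -/
lemma isB2AlmostPeriodic_of_summable_sq (hpos : ∀ n, 0 < lam n)
    (hsum : Summable fun k => (∑ n ∈ freqBin h k, ‖r n‖) ^ 2) (hy₀ : 0 ≤ y₀)
    (hφ : MemLp φ 2 (volume.restrict (Set.Icc 0 y₀)))
    (hformula : ∀ y, y₀ ≤ y → ∀ X, X₀ ≤ X →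
      φ y = c + (∑ n ∈ freqsLE h X,
        r n * Complex.exp (Complex.I * (lam n : ℂ) * (y : ℂ))).re + E y X)
    (hE_L2 : ∀ᶠ Y : ℝ in atTop,
      MemLp (fun y => E y (Real.exp Y)) 2 (volume.restrict (Set.Icc y₀ Y)))
    (hE : Tendsto (fun Y : ℝ => (1 / Y) * ∫ y in y₀..Y, |E y (Real.exp Y)| ^ 2) atTop (𝓝 0)) :
    IsB2AlmostPeriodic φ := by
  have hloc := memLp_two_of_formula h hφ hformula hE_L2
  refine ⟨hloc, fun ε hε => ?_⟩
  have hε2 : 0 < ε ^ 2 := by positivity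
  -- The factor `16` of the mean square bound and the factor `2` from `(a + b)² ≤ 2 a² + 2 b²`
  -- turn this into `ε² / 4`.
  obtain ⟨K, hK⟩ := exists_forall_integral_tail_le h hpos hsum
    (by positivity : (0 : ℝ) < ε ^ 2 / 128)
  set P : ℝ → ℝ := fun y =>
    c + (∑ n ∈ freqsLE h K, r n * Complex.exp (Complex.I * (lam n : ℂ) * (y : ℂ))).re with hPdef
  have hP : IsRealTrigPoly P := isRealTrigPoly_const_add_re_sum c lam r _
  refine ⟨P, hP, ?_⟩
  have hinit : Tendsto (fun Y : ℝ => (1 / Y) * ∫ y in (0 : ℝ)..y₀, |φ y - P y| ^ 2)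
      atTop (𝓝 0) := by
    simpa only [one_div, zero_mul] using
      (tendsto_inv_atTop_zero (𝕜 := ℝ)).mul_const (∫ y in (0 : ℝ)..y₀, |φ y - P y| ^ 2)
  refine lt_of_le_of_lt (limsup_le_of_le (a := ((ε ^ 2 / 2 : ℝ) : EReal)) (by isBoundedDefault) ?_)
    (EReal.coe_lt_coe_iff.mpr (by linarith))
  filter_upwards [hE.eventually_lt_const (by positivity : 0 < ε ^ 2 / 16),
    hinit.eventually_lt_const (by positivity : 0 < ε ^ 2 / 8), hE_L2, eventually_ge_atTop 1,
    eventually_ge_atTop y₀, Real.tendsto_exp_atTop.eventually_ge_atTop X₀,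
    Real.tendsto_exp_atTop.eventually_ge_atTop (K : ℝ)] with Y hEY hinitY hL2 hY1 hYy hYX hYK
  refine EReal.coe_le_coe_iff.mpr ?_
  have hY0 : 0 < Y := by linarith
  set s := (freqsLE h (Real.exp Y)).filter (fun n => ¬ lam n ≤ K) with hs
  set S : ℝ → ℂ := fun y => ∑ n ∈ s, r n * Complex.exp (Complex.I * (lam n : ℂ) * (y : ℂ)) with hS
  have hScont : Continuous S := continuous_sum_exp lam r s
  have hSint : ∀ a b, IntervalIntegrable (fun y => ‖S y‖ ^ 2) volume a b := fun a b =>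
    Continuous.intervalIntegrable (by fun_prop) _ _
  have hdiff : ∀ y, y₀ ≤ y → φ y - P y = (S y).re + E y (Real.exp Y) := by
    intro y hy
    have hfilter : (freqsLE h (Real.exp Y)).filter (fun n => lam n ≤ K) = freqsLE h K := by
      ext n
      rw [Finset.mem_filter, mem_freqsLE, mem_freqsLE]
      exact ⟨fun H => H.2, fun H => ⟨H.trans hYK, H⟩⟩
    rw [hformula y hy _ hYX, ← Finset.sum_filter_add_sum_filter_not _ (fun n => lam n ≤ (K : ℝ)),
      hfilter, Complex.add_re]
    simp only [hPdef, hS, hs]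
    ring
  have hint : ∀ a b, 0 ≤ a → a ≤ b → IntervalIntegrable (fun y => |φ y - P y| ^ 2) volume a b := by
    intro a b ha hab
    refine intervalIntegrable_sq_of_memLp (g := fun y => φ y - P y) hab ?_
    exact ((hloc b).mono_measure (Measure.restrict_mono (Set.Icc_subset_Icc_left ha) le_rfl)).sub
      (hP.memLp a b)
  have hEint := intervalIntegrable_sq_of_memLp hYy hL2
  have hSle : ∫ y in y₀..Y, ‖S y‖ ^ 2 ≤ 16 * Y * (ε ^ 2 / 128) := by
    refine le_trans ?_ (hK Y hY1)
    exact intervalIntegral.integral_mono_interval hy₀ hYy le_rfl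
      (Eventually.of_forall fun y => sq_nonneg _) (hSint 0 Y)
  have hmain : ∫ y in y₀..Y, |φ y - P y| ^ 2 ≤
      2 * (∫ y in y₀..Y, ‖S y‖ ^ 2) + 2 * ∫ y in y₀..Y, |E y (Real.exp Y)| ^ 2 := by
    rw [← intervalIntegral.integral_const_mul, ← intervalIntegral.integral_const_mul,
      ← intervalIntegral.integral_add ((hSint _ _).const_mul _) (hEint.const_mul _)]
    refine intervalIntegral.integral_mono_on hYy (hint _ _ hy₀ hYy)
      (((hSint _ _).const_mul _).add (hEint.const_mul _)) fun y hy => ?_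
    have h1 : (S y).re ^ 2 ≤ ‖S y‖ ^ 2 := by
      rw [← sq_abs]
      exact pow_le_pow_left₀ (abs_nonneg _) (Complex.abs_re_le_norm _) 2
    rw [hdiff y hy.1, sq_abs, sq_abs]
    nlinarith [sq_nonneg ((S y).re - E y (Real.exp Y))]
  rw [← intervalIntegral.integral_add_adjacent_intervals (hint 0 y₀ le_rfl hy₀) (hint y₀ Y hy₀ hYy),
    mul_add]
  have h2 : (1 / Y) * ∫ y in y₀..Y, |φ y - P y| ^ 2 ≤
      ε ^ 2 / 4 + 2 * ((1 / Y) * ∫ y in y₀..Y, |E y (Real.exp Y)| ^ 2) := by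
    calc _ ≤ (1 / Y) * (2 * (16 * Y * (ε ^ 2 / 128)) +
          2 * ∫ y in y₀..Y, |E y (Real.exp Y)| ^ 2) := by
          refine mul_le_mul_of_nonneg_left (hmain.trans ?_) (by positivity)
          linarith
      _ = _ := by field_simp; ring
  linarith

end

/-! ### The explicit formula with frequencies of logarithmic density -/

theorem mainTheorem2
    (φ : ℝ → ℝ) (y₀ : ℝ) (hy₀ : 0 ≤ y₀)
    (hφ : MemLp φ 2 (volume.restrict (Set.Icc 0 y₀)))
    (lam : ℕ → ℝ) (hlam_mono : Monotone lam) (hlam_pos : ∀ n, 0 < lam n)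
    (hlam_top : Tendsto lam atTop atTop)
    (r : ℕ → ℂ) (c X₀ : ℝ) (hX₀ : 0 < X₀) (E : ℝ → ℝ → ℝ)
    (hformula : ∀ y, y₀ ≤ y → ∀ X, X₀ ≤ X →
      φ y = c + (∑ᶠ (n : ℕ) (_ : lam n ≤ X),
        r n * Complex.exp (Complex.I * (lam n : ℂ) * (y : ℂ))).re + E y X)
    (hE_L2 : ∀ᶠ Y : ℝ in atTop,
      MemLp (fun y => E y (Real.exp Y)) 2 (volume.restrict (Set.Icc y₀ Y)))
    (hE : Tendsto (fun Y : ℝ => (1 / Y) * ∫ y in y₀..Y, |E y (Real.exp Y)| ^ 2) atTop (𝓝 0))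
    (hcond :
      (∃ β : ℝ, 1 / 2 < β ∧
        (r =O[atTop] fun n => lam n ^ (-β)) ∧
        ((fun T : ℝ => (Set.ncard {n : ℕ | T < lam n ∧ lam n ≤ T + 1} : ℝ))
          =O[atTop] fun T => Real.log T)) ∨
      (∃ θ : ℝ, 0 ≤ θ ∧ θ < 3 - Real.sqrt 3 ∧
        ((fun T : ℝ => (Set.ncard {n : ℕ | T < lam n ∧ lam n ≤ T + 1} : ℝ))
          =O[atTop] fun T => Real.log T) ∧
        ((fun T : ℝ => ∑ᶠ (n : ℕ) (_ : lam n ≤ T), lam n ^ 2 * ‖r n‖ ^ 2)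
          =O[atTop] fun T => T ^ θ))) :
    IsB2AlmostPeriodic φ ∧ ∃ μ : Measure ℝ, HasLimitingDistribution φ μ := by
  simp only [finsum_eq_sum_freqsLE hlam_top (fun n => r n * _)] at hformula
  have hsum : Summable fun k => (∑ n ∈ freqBin hlam_top k, ‖r n‖) ^ 2 := by
    rcases hcond with ⟨β, hβ, hr, hcount⟩ | ⟨θ, hθ0, hθ, hcount, hsq⟩
    · exact summable_sq_sum_freqBin_of_isBigO_rpow hlam_top hlam_pos hβ hr hcount
    · have h3 : (1 : ℝ) ≤ Real.sqrt 3 := Real.one_le_sqrt.mpr (by norm_num)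
      exact summable_sq_sum_freqBin_of_sum_sq_isBigO hlam_top hθ0 (by linarith) hsq hcount
  have hB2 := isB2AlmostPeriodic_of_summable_sq hlam_top hlam_pos hsum hy₀ hφ hformula hE_L2 hE
  exact ⟨hB2, hB2.exists_hasLimitingDistribution⟩
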